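/- Let $\beta>1$ be a real number, let $T_\beta(x)=\beta x-\lfloor\beta x\rfloor$ on $[0,1]$, and let $d_\beta(1)=t_1t_2t_3\cdots$ with $t_i=\lfloor\beta T_\beta^{i-1}(1)\rfloor$ be the Rényi expansion of $1$. Suppose that, for some integers $m\ge 2$ and $t,s$ with $s\neq 0$, this expansion is finite of the form $t_1=\cdots=t_{m-1}=t$, $t_m=s$, and $t_i=0$ for $i>m$ (that is, $\beta$ is a confluent Pisot number; then automatically $t\ge s\ge 1$). Let $\mathcal A=\{0,1,\dots,m-1\}$, let $\varphi$ be the substitution on $\mathcal A$ given by $\varphi(a)=0^t(a+1)$ for $0\le a\le m-2$ and $\varphi(m-1)=0^s$, and let $u_\beta=\lim_{n\to\infty}\varphi^n(0)$ be its fixed point. For a center $c\in\mathcal A\cup\{\varepsilon\}$ (where $\varepsilon$ is the empty word), an infinite palindromic branch of $u_\beta$ with center $c$ is a two-sided infinite word $\cdots v_3v_2v_1\,c\,v_1v_2v_3\cdots$ over $\mathcal A$ (considered together with the position of its center) such that for every $n\ge 1$ the palindrome $v_n\cdots v_1\,c\,v_1\cdots v_n$ is a factor of $u_\beta$. Then: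 (i) If $s$ is odd, then for every $c\in\mathcal A\cup\{\varepsilon\}$ the word $u_\beta$ has exactly one infinite palindromic branch with center $c$. (ii) If $s$ is even and $t$ is odd, then for every $c\in\mathcal A$ the word $u_\beta$ has exactly one infinite palindromic branch with center $c$, and it has no infinite palindromic branch with center $\varepsilon$. (iii) If $s$ is even and $t$ is even, then $u_\beta$ has exactly one infinite palindromic branch with center $\varepsilon$, and it has no infinite palindromic branch with center $a$ for any $a\in\mathcal A$. -/

import Mathlib

/-- The `β`-transformation `T_β(x) = βx - ⌊βx⌋`. -/
noncomputable def betaTransform (β x : ℝ) : ℝ := Int.fract (β * x)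

/-- The digit `t_i = ⌊β T_β^{i-1}(1)⌋`, `i ≥ 1`, of the Rényi expansion
`d_β(1) = t_1 t_2 t_3 ⋯` (the value at `i = 0` is never used). -/
noncomputable def renyiDigit (β : ℝ) (i : ℕ) : ℕ := ⌊β * (betaTransform β)^[i - 1] 1⌋₊

/-- `β` is a simple Parry number with `d_β(1) = t_1 ⋯ t_m`, `t_m ≠ 0` (ending zeros omitted). -/
structure IsSimpleParry (β : ℝ) (m : ℕ) : Prop where
  one_lt : 1 < β
  length_pos : 1 ≤ m
  last_ne_zero : renyiDigit β m ≠ 0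
  eq_zero : ∀ i, m < i → renyiDigit β i = 0

/-- `β` is a confluent Pisot number with `d_β(1) = t_1 ⋯ t_m`, where
`t_1 = ⋯ = t_{m-1} = t` (and `m ≥ 2`, so that `t` is determined) and `t_m = s`. -/
structure IsConfluent (β : ℝ) (m t s : ℕ) : Prop where
  simpleParry : IsSimpleParry β m
  two_le : 2 ≤ m
  digit_eq : ∀ i, 1 ≤ i → i < m → renyiDigit β i = t
  digit_last : renyiDigit β m = s

/-- The canonical substitution on the alphabet `{0, …, m-1}` attached to `t_1 ⋯ t_m`:
`a ↦ 0^{t_{a+1}} (a+1)` for `a < m-1`, and `m-1 ↦ 0^{t_m}`. -/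
def parrySubst (d : ℕ → ℕ) (m : ℕ) [NeZero m] (a : Fin m) : List (Fin m) :=
  List.replicate (d (a + 1)) 0 ++ (if h : (a : ℕ) + 1 < m then [⟨a + 1, h⟩] else [])

/-- The morphism of the free monoid of finite words determined by images of letters. -/
def applyMorphism {A : Type*} (φ : A → List A) (w : List A) : List A := w.flatMap φ

/-- The word `φ_β^n(0)`. -/
noncomputable def betaIterate (β : ℝ) (m : ℕ) [NeZero m] (n : ℕ) : List (Fin m) :=
  (applyMorphism (parrySubst (renyiDigit β) m))^[n] [0]

/-- The right infinite word `u_β = lim φ_β^n(0)`. The letter with index `k` is read off from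
`φ_β^k(0)`, which is long enough; see `betaIterate_length` and `uBeta_eq` below. -/
noncomputable def uBeta (β : ℝ) (m : ℕ) [NeZero m] (k : ℕ) : Fin m :=
  (betaIterate β m k).getD k 0

/-- `w` is a factor of the right infinite word `u`, i.e. `w = u_k u_{k+1} ⋯ u_{k+|w|-1}`. -/
def IsFactor {A : Type*} (u : ℕ → A) (w : List A) : Prop :=
  ∃ k, w = (List.range w.length).map fun j => u (k + j)

/-- The set of palindromes in the language of `u`. -/
def Pal {A : Type*} (u : ℕ → A) : Set (List A) := {w | IsFactor u w ∧ w.reverse = w}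

/-- For a left infinite word `v = ⋯ v_3 v_2 v_1` (with `v_{i+1}` given as `v i`) and a center `c`
(a letter `some a`, or the empty word `none`), the finite word `v_n ⋯ v_1 c v_1 ⋯ v_n`. -/
def centralWord {A : Type*} (c : Option A) (v : ℕ → A) (n : ℕ) : List A :=
  ((List.range n).map v).reverse ++ c.toList ++ (List.range n).map v

/-- The two-sided infinite word `⋯ v_2 v_1 c v_1 v_2 ⋯`. If `c` is a letter, it has index `0`;
if `c` is empty, the right half begins at index `0`. -/
def twoSidedWord {A : Type*} (c : Option A) (v : ℕ → A) (i : ℤ) : A :=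
  match c with
  | some a => if i = 0 then a else v (i.natAbs - 1)
  | none => if 0 ≤ i then v i.toNat else v (i.natAbs - 1)

/-- The two-sided infinite word `w` is an infinite palindromic branch of `u` with center `c`. -/
def IsInfinitePalindromicBranch {A : Type*} (u : ℕ → A) (c : Option A) (w : ℤ → A) : Prop :=
  ∃ v : ℕ → A, w = twoSidedWord c v ∧ ∀ n, 1 ≤ n → centralWord c v n ∈ Pal u

theorem betaIterate_succ (β : ℝ) (m : ℕ) [NeZero m] (n : ℕ) :
    betaIterate β m (n + 1) = applyMorphism (parrySubst (renyiDigit β) m) (betaIterate β m n) :=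
  Function.iterate_succ_apply' _ _ _

theorem betaIterate_step {β : ℝ} {m : ℕ} [NeZero m] (hβ : IsSimpleParry β m) (hm : 2 ≤ m) (n : ℕ) :
    ∃ r, r ≠ [] ∧ betaIterate β m (n + 1) = betaIterate β m n ++ r := by
  induction n with
  | zero =>
    have h1 : 1 ≤ renyiDigit β 1 := by
      have := hβ.one_lt
      simp only [renyiDigit, Nat.sub_self, Function.iterate_zero, id]
      exact Nat.le_floor (by simpa using this.le)
    obtain ⟨k, hk⟩ := Nat.exists_eq_add_of_le h1
    refine ⟨List.replicate k 0 ++ [⟨1, hm⟩], by simp, ?_⟩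
    have h2 : 1 < m := hm
    simp [betaIterate, applyMorphism, parrySubst, hk, h2, Nat.add_comm 1 k, List.replicate_succ]
  | succ n ih =>
    obtain ⟨r, hr, h⟩ := ih
    refine ⟨applyMorphism (parrySubst (renyiDigit β) m) r, ?_, ?_⟩
    · obtain ⟨a, l, rfl⟩ := List.exists_cons_of_ne_nil hr
      simp only [applyMorphism, List.flatMap_cons, ne_eq, List.append_eq_nil_iff, not_and_or]
      left
      simp only [parrySubst]
      split_ifs with ha
      · simp
      · have : (a : ℕ) + 1 = m := by omega
        simp [this, hβ.last_ne_zero]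
    · rw [betaIterate_succ, h, applyMorphism, List.flatMap_append, ← applyMorphism,
        ← betaIterate_succ, h, applyMorphism]

theorem betaIterate_length {β : ℝ} {m : ℕ} [NeZero m] (hβ : IsSimpleParry β m) (hm : 2 ≤ m)
    (n : ℕ) : n < (betaIterate β m n).length := by
  induction n with
  | zero => simp [betaIterate]
  | succ n ih =>
    obtain ⟨r, hr, h⟩ := betaIterate_step hβ hm n
    have := List.length_pos_of_ne_nil hr
    rw [h, List.length_append]
    omega

theorem betaIterate_prefix {β : ℝ} {m : ℕ} [NeZero m] (hβ : IsSimpleParry β m) (hm : 2 ≤ m)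
    {k n : ℕ} (hkn : k ≤ n) : betaIterate β m k <+: betaIterate β m n := by
  induction n, hkn using Nat.le_induction with
  | base => exact List.prefix_rfl
  | succ n _ ih =>
    obtain ⟨r, _, h⟩ := betaIterate_step hβ hm n
    exact ih.trans ⟨r, h.symm⟩

/-- Every `φ_β^n(0)` is a prefix of `u_β`, as the definition of the limit requires. -/
theorem uBeta_eq {β : ℝ} {m : ℕ} [NeZero m] (hβ : IsSimpleParry β m) (hm : 2 ≤ m)
    (n k : ℕ) (hk : k < (betaIterate β m n).length) : uBeta β m k = (betaIterate β m n)[k] := by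
  have h := betaIterate_length hβ hm k
  rw [uBeta, List.getD_eq_getElem _ _ h]
  rcases le_total k n with hkn | hkn
  · exact (betaIterate_prefix hβ hm hkn).getElem h
  · exact ((betaIterate_prefix hβ hm hkn).getElem hk).symm

/-! Write ψ for the mirror image of φ. The two substitutions are conjugate: φ(w)0^t = 0^t ψ(w).
Hence w ↦ φ(w)0^t sends palindromes to palindromes, and factors of the fixed point u to factors of
u, because the image of any letter of u starts a run of at least t zeros. The center of the image
depends only on the old center: a ↦ a+1 for a < m-1, while m-1 and ε go to the centers of 0^(t+s)
and 0^t (`mirrorWord_halfMap`).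

Conversely, maximal zero runs following a nonzero letter of u have length t or t+s, so a branch can
be decoded: every branch is the image of a branch (`exists_preimage_branch`). Everything then
reduces to the dynamics of `centerMap` on the m+1 centers. A periodic center that occurs in u and
whose image gains zeros carries palindromes of unbounded length. A center with no preimage carries
no branch. If at most one preimage of each center carries branches, two branches with a common
center have preimages with a common center, and their agreement lengthens without bound under
repeated desubstitution (`isBranchHalf_unique`).

For s odd the map is a permutation: an m-cycle of letters and the fixed point ε if t is even, one
(m+1)-cycle if t is odd. For s even and t odd, the letters form a cycle and ε has no preimage. For s
and t even, ε is fixed and 0 has no preimage, so by descent no letter carries a branch. -/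

/-- The finite word `l` is a prefix of the infinite word `v`. -/
def IsInitial {A : Type*} (v : ℕ → A) (l : List A) : Prop :=
  l = (List.range l.length).map v

/-! ### Words, central palindromes and halves of branches -/

section Words

variable {A : Type*}

theorem isInitial_iff {v : ℕ → A} {l : List A} :
    IsInitial v l ↔ ∀ i (h : i < l.length), l[i] = v i := by
  unfold IsInitial
  constructor
  · intro h i hi
    have := List.getElem_of_eq h hi
    simpa using this
  · intro h
    apply List.ext_getElem
    · simp
    · intro i h1 h2
      simpa using h i h1

theorem isInitial_append {v : ℕ → A} {l₁ l₂ : List A} :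
    IsInitial v (l₁ ++ l₂) ↔ IsInitial v l₁ ∧ IsInitial (fun j => v (l₁.length + j)) l₂ := by
  simp only [isInitial_iff]
  constructor
  · intro h
    refine ⟨fun i hi => ?_, fun i hi => ?_⟩
    · rw [← h i (by simp; omega), List.getElem_append_left hi]
    · rw [← h (l₁.length + i) (by simp; omega), List.getElem_append_right (by omega)]
      simp
  · rintro ⟨h1, h2⟩ i hi
    rcases lt_or_ge i l₁.length with h | h
    · rw [List.getElem_append_left h, h1]
    · rw [List.getElem_append_right h, h2]
      congr 1
      omega

theorem isInitial_replicate {v : ℕ → A} {n : ℕ} {a : A} :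
    IsInitial v (List.replicate n a) ↔ ∀ j < n, v j = a := by
  simp only [isInitial_iff, List.length_replicate, List.getElem_replicate]
  exact forall₂_congr fun _ _ => eq_comm

theorem isInitial_singleton {v : ℕ → A} {a : A} : IsInitial v [a] ↔ v 0 = a := by
  rw [show [a] = List.replicate 1 a from rfl, isInitial_replicate]
  simp

theorem isInitial_range (v : ℕ → A) (n : ℕ) : IsInitial v ((List.range n).map v) := by
  simp [IsInitial]

theorem IsInitial.of_prefix {v : ℕ → A} {l₁ l₂ : List A} (h : l₁ <+: l₂) (h₂ : IsInitial v l₂) :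
    IsInitial v l₁ := by
  obtain ⟨r, rfl⟩ := h
  exact (isInitial_append.1 h₂).1

theorem IsInitial.getElem {v : ℕ → A} {l : List A} (h : IsInitial v l) {i : ℕ}
    (hi : i < l.length) : l[i] = v i :=
  isInitial_iff.1 h i hi

theorem map_range_congr {v w : ℕ → A} {n : ℕ} (h : ∀ i < n, v i = w i) :
    (List.range n).map v = (List.range n).map w :=
  List.map_congr_left fun i hi => h i (List.mem_range.1 hi)

theorem map_range_prefix (v : ℕ → A) {n k : ℕ} (h : n ≤ k) :
    (List.range n).map v <+: (List.range k).map v := by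
  obtain ⟨d, rfl⟩ := Nat.exists_eq_add_of_le h
  rw [List.range_add, List.map_append]
  exact List.prefix_append _ _

theorem map_range_succ (v : ℕ → A) (n : ℕ) :
    (List.range (n + 1)).map v = (List.range n).map v ++ [v n] := by
  simp [List.range_succ]

theorem isFactor_iff {u : ℕ → A} {w : List A} :
    IsFactor u w ↔ ∃ k, IsInitial (fun j => u (k + j)) w :=
  Iff.rfl

theorem IsFactor.of_infix {u : ℕ → A} {w w' : List A} (h : IsFactor u w) (hw : w' <:+: w) :
    IsFactor u w' := by
  obtain ⟨k, hk⟩ := isFactor_iff.1 h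
  obtain ⟨a, b, rfl⟩ := hw
  rw [isInitial_append, isInitial_append] at hk
  refine isFactor_iff.2 ⟨k + a.length, ?_⟩
  simpa [Nat.add_assoc] using hk.1.2

/-- The palindrome whose right half is the finite word `h` and whose center is `c`. -/
def mirrorWord (c : Option A) (h : List A) : List A := h.reverse ++ c.toList ++ h

theorem centralWord_eq (c : Option A) (v : ℕ → A) (n : ℕ) :
    centralWord c v n = mirrorWord c ((List.range n).map v) := rfl

theorem reverse_toList (c : Option A) : c.toList.reverse = c.toList := by
  cases c <;> rfl

theorem reverse_mirrorWord (c : Option A) (h : List A) :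
    (mirrorWord c h).reverse = mirrorWord c h := by
  simp [mirrorWord, reverse_toList]

theorem mirrorWord_infix (c : Option A) {h h' : List A} (hh : h <+: h') :
    mirrorWord c h <:+: mirrorWord c h' := by
  obtain ⟨r, rfl⟩ := hh
  exact ⟨r.reverse, r, by simp [mirrorWord]⟩

/-- `v` is the right half of an infinite palindromic branch of `u` with center `c`. -/
def IsBranchHalf (u : ℕ → A) (c : Option A) (v : ℕ → A) : Prop :=
  ∀ n, IsFactor u (centralWord c v n)

theorem centralWord_mem_pal_iff {u : ℕ → A} {c : Option A} {v : ℕ → A} :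
    (∀ n, 1 ≤ n → centralWord c v n ∈ Pal u) ↔ IsBranchHalf u c v := by
  constructor
  · intro h n
    exact (h (n + 1) (by omega)).1.of_infix
      (mirrorWord_infix c (map_range_prefix v (Nat.le_succ n)))
  · intro h n _
    exact ⟨h n, reverse_mirrorWord _ _⟩

theorem twoSidedWord_injective (c : Option A) : Function.Injective (twoSidedWord c) := by
  intro v w h
  funext i
  cases c with
  | none =>
    have := congrFun h (i : ℤ)
    simpa [twoSidedWord] using this
  | some a =>
    have := congrFun h ((i : ℤ) + 1)
    have h0 : ((i : ℤ) + 1) ≠ 0 := by omega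
    have h1 : ((i : ℤ) + 1).natAbs - 1 = i := by omega
    simpa [twoSidedWord, h0, h1] using this

theorem existsUnique_branch_iff {u : ℕ → A} {c : Option A} :
    (∃! w, IsInfinitePalindromicBranch u c w) ↔ ∃! v, IsBranchHalf u c v := by
  simp only [IsInfinitePalindromicBranch, centralWord_mem_pal_iff]
  constructor
  · rintro ⟨_, ⟨v, rfl, hv⟩, h⟩
    exact ⟨v, hv, fun v' hv' => twoSidedWord_injective c (h _ ⟨v', rfl, hv'⟩)⟩
  · rintro ⟨v, hv, h⟩
    refine ⟨_, ⟨v, rfl, hv⟩, ?_⟩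
    rintro _ ⟨v', rfl, hv'⟩
    rw [h v' hv']

theorem exists_branch_iff {u : ℕ → A} {c : Option A} :
    (∃ w, IsInfinitePalindromicBranch u c w) ↔ ∃ v, IsBranchHalf u c v := by
  simp only [IsInfinitePalindromicBranch, centralWord_mem_pal_iff]
  exact ⟨fun ⟨_, v, _, hv⟩ => ⟨v, hv⟩, fun ⟨v, hv⟩ => ⟨_, v, rfl, hv⟩⟩

/-- An occurrence of a central palindrome, read off letter by letter. -/
theorem IsBranchHalf.exists_occurrence {u : ℕ → A} {c : Option A} {v : ℕ → A}
    (h : IsBranchHalf u c v) (n : ℕ) :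
    ∃ k, (∀ j < n, u (k + (n - 1 - j)) = v j) ∧ (∀ a, c = some a → u (k + n) = a) ∧
      ∀ j < n, u (k + (n + c.toList.length) + j) = v j := by
  obtain ⟨k, hk⟩ := isFactor_iff.1 (h n)
  rw [centralWord, isInitial_append, isInitial_append] at hk
  obtain ⟨⟨h1, h2⟩, h3⟩ := hk
  simp only [isInitial_iff, List.length_append, List.length_reverse, List.length_map,
    List.length_range, List.getElem_reverse, List.getElem_map, List.getElem_range] at h1 h2 h3
  refine ⟨k, fun j hj => ?_, ?_, fun j hj => ?_⟩
  · rw [← h1 (n - 1 - j) (by omega)]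
    congr 1
    omega
  · rintro a rfl
    simpa using (h2 0 (by simp)).symm
  · rw [h3 j hj, Nat.add_assoc]

/-- Nested finite palindromes with a common center have a limit. -/
theorem exists_isBranchHalf_of_chain {u : ℕ → A} {c : Option A} {h : ℕ → List A}
    (hchain : ∀ k, h k <+: h (k + 1)) (hlen : ∀ k, k ≤ (h k).length)
    (hfac : ∀ k, IsFactor u (mirrorWord c (h k))) : ∃ v, IsBranchHalf u c v := by
  have hpre : ∀ {k n}, k ≤ n → h k <+: h n := by
    intro k n hkn
    induction n, hkn using Nat.le_induction with
    | base => exact List.prefix_rfl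
    | succ n _ ih => exact ih.trans (hchain n)
  -- Letter i is read from `h (i + 1)`, the first half guaranteed to be long enough.
  refine ⟨fun i => (h (i + 1))[i]'(hlen (i + 1)), fun n => ?_⟩
  refine (hfac n).of_infix (mirrorWord_infix c ?_)
  rw [List.prefix_iff_eq_take]
  apply List.ext_getElem
  · simpa using hlen n
  · intro i h1 h2
    have hi : i < n := by simpa using h1
    simpa using (hpre (show i + 1 ≤ n from hi)).getElem (hlen (i + 1))

end Words

/-! ### The substitution, its conjugate, and images of palindromes -/

section Substitution

variable {m : ℕ} [NeZero m]

/-- The substitution `a ↦ 0^t (a+1)` for `a < m - 1`, `m - 1 ↦ 0^s`. -/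
def confluentSubst (t s : ℕ) (a : Fin m) : List (Fin m) :=
  if h : (a : ℕ) + 1 < m then List.replicate t 0 ++ [⟨a + 1, h⟩] else List.replicate s 0

/-- The conjugate substitution `a ↦ (a+1) 0^t` for `a < m - 1`, `m - 1 ↦ 0^s`. -/
def conjSubst (t s : ℕ) (a : Fin m) : List (Fin m) :=
  if h : (a : ℕ) + 1 < m then ⟨a + 1, h⟩ :: List.replicate t 0 else List.replicate s 0

theorem applyMorphism_append {A : Type*} (φ : A → List A) (x y : List A) :
    applyMorphism φ (x ++ y) = applyMorphism φ x ++ applyMorphism φ y :=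
  List.flatMap_append

theorem applyMorphism_cons {A : Type*} (φ : A → List A) (a : A) (x : List A) :
    applyMorphism φ (a :: x) = φ a ++ applyMorphism φ x :=
  List.flatMap_cons

theorem applyMorphism_nil {A : Type*} (φ : A → List A) : applyMorphism φ [] = [] := rfl

theorem applyMorphism_singleton {A : Type*} (φ : A → List A) (a : A) :
    applyMorphism φ [a] = φ a := by
  simp [applyMorphism]

theorem applyMorphism_prefix {A : Type*} (φ : A → List A) {x y : List A} (h : x <+: y) :
    applyMorphism φ x <+: applyMorphism φ y := by
  obtain ⟨r, rfl⟩ := h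
  rw [applyMorphism_append]
  exact List.prefix_append _ _

theorem reverse_confluentSubst (t s : ℕ) (a : Fin m) :
    (confluentSubst t s a).reverse = conjSubst t s a := by
  unfold confluentSubst conjSubst
  split_ifs <;> simp

/-- This is where confluence enters: every image but the last has the same number t of zeros, and
the last image is itself a power of 0. -/
theorem confluentSubst_append_replicate (t s : ℕ) (a : Fin m) :
    confluentSubst t s a ++ List.replicate t 0 = List.replicate t 0 ++ conjSubst t s a := by
  unfold confluentSubst conjSubst
  split_ifs
  · simp
  · simp [Nat.add_comm]

theorem applyMorphism_append_replicate (t s : ℕ) (x : List (Fin m)) :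
    applyMorphism (confluentSubst t s) x ++ List.replicate t 0 =
      List.replicate t 0 ++ applyMorphism (conjSubst t s) x := by
  induction x with
  | nil => simp [applyMorphism]
  | cons a x ih =>
    rw [applyMorphism_cons, applyMorphism_cons, List.append_assoc, ih, ← List.append_assoc,
      confluentSubst_append_replicate, List.append_assoc]

theorem reverse_applyMorphism_conjSubst (t s : ℕ) (x : List (Fin m)) :
    (applyMorphism (conjSubst t s) x).reverse =
      applyMorphism (confluentSubst t s) x.reverse := by
  induction x with
  | nil => rfl
  | cons a x ih =>
    rw [applyMorphism_cons, List.reverse_append, ih, List.reverse_cons, applyMorphism_append,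
      applyMorphism_singleton, ← reverse_confluentSubst, List.reverse_reverse]

theorem length_le_length_applyMorphism {A : Type*} {φ : A → List A} (hφ : ∀ a, 1 ≤ (φ a).length)
    (x : List A) : x.length ≤ (applyMorphism φ x).length := by
  induction x with
  | nil => simp
  | cons a x ih =>
    rw [applyMorphism_cons, List.length_append, List.length_cons]
    have := hφ a
    omega

theorem one_le_length_conjSubst {t s : ℕ} (hs : 1 ≤ s) (a : Fin m) :
    1 ≤ (conjSubst t s a).length := by
  unfold conjSubst
  split_ifs <;> simp [hs]

theorem one_le_length_confluentSubst {t s : ℕ} (hs : 1 ≤ s) (a : Fin m) :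
    1 ≤ (confluentSubst t s a).length := by
  unfold confluentSubst
  split_ifs <;> simp [hs]

/-- The letter whose image under the substitution ends in `b`. -/
theorem exists_conjSubst_eq (hm : 2 ≤ m) (t s : ℕ) (b : Fin m) :
    ∃ a : Fin m, ((a : ℕ) + 1 < m ↔ b ≠ 0) ∧
      conjSubst t s a = if b = 0 then List.replicate s 0 else b :: List.replicate t 0 := by
  by_cases hb : b = 0
  · refine ⟨⟨m - 1, by omega⟩, ?_, ?_⟩
    · simp only [hb, ne_eq, not_true_eq_false, iff_false]
      omega
    · rw [conjSubst, dif_neg (by simp only; omega), if_pos hb]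
  · have hb' : (b : ℕ) ≠ 0 := fun h => hb (Fin.ext h)
    have hlt := b.isLt
    refine ⟨⟨b - 1, by omega⟩, ?_, ?_⟩
    · simp only [ne_eq, hb, not_false_eq_true, iff_true]
      omega
    · rw [conjSubst, dif_pos (by simp only; omega), if_neg hb]
      congr 1
      apply Fin.ext
      simp only
      omega

/-- The final letter of an image is a+1 modulo m, so it identifies a; decoding from right to left
rests on this. -/
theorem confluentSubst_eq_append {t s : ℕ} (hs : 1 ≤ s) (a : Fin m) :
    ∃ (l : List (Fin m)) (b : Fin m), confluentSubst t s a = l ++ [b] ∧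
      (b : ℕ) = if (a : ℕ) + 1 < m then (a : ℕ) + 1 else 0 := by
  unfold confluentSubst
  split_ifs with h
  · exact ⟨_, _, rfl, rfl⟩
  · obtain ⟨r, rfl⟩ := Nat.exists_eq_add_of_le' hs
    exact ⟨List.replicate r 0, 0, by rw [List.replicate_succ'], by simp⟩

/-- The substitution is a suffix code. -/
theorem suffix_of_applyMorphism_suffix {t s : ℕ} (hs : 1 ≤ s) (x y : List (Fin m))
    (h : applyMorphism (confluentSubst t s) x <:+ applyMorphism (confluentSubst t s) y) :
    x <:+ y := by
  induction x using List.reverseRecOn generalizing y with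
  | nil => exact List.nil_suffix
  | append_singleton x a ih =>
    rcases List.eq_nil_or_concat' y with rfl | ⟨y, b, rfl⟩
    · have h1 := h.length_le
      rw [applyMorphism_append, applyMorphism_singleton, applyMorphism_nil,
        List.length_append, List.length_nil] at h1
      have := one_le_length_confluentSubst (t := t) hs a
      omega
    · rw [applyMorphism_append, applyMorphism_append, applyMorphism_singleton,
        applyMorphism_singleton] at h
      have hab : a = b := by
        obtain ⟨l, p, hl, hp⟩ := confluentSubst_eq_append (t := t) hs a
        obtain ⟨l', q, hl', hq⟩ := confluentSubst_eq_append (t := t) hs b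
        rw [hl, hl', ← List.append_assoc, ← List.append_assoc] at h
        obtain ⟨r, hr⟩ := h
        rw [← List.append_assoc] at hr
        have hpq : p = q := by
          simpa using (List.append_inj' hr rfl).2
        rw [hpq, hq] at hp
        apply Fin.ext
        have := a.isLt
        have := b.isLt
        split_ifs at hp <;> omega
      subst hab
      obtain ⟨r, hr⟩ := h
      rw [← List.append_assoc] at hr
      obtain ⟨r', hr'⟩ := ih y ⟨r, (List.append_inj' hr rfl).1⟩
      exact ⟨r', by rw [← List.append_assoc, hr']⟩

/-- The center of a block of `n` zeros. -/
def blockCenter (m : ℕ) [NeZero m] (n : ℕ) : Option (Fin m) := if Odd n then some 0 else none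

theorem replicate_eq_mirrorWord (n : ℕ) :
    List.replicate n (0 : Fin m) = mirrorWord (blockCenter m n) (List.replicate (n / 2) 0) := by
  have h : (blockCenter m n).toList = List.replicate (n % 2) 0 := by
    unfold blockCenter
    split_ifs with h
    · rw [Nat.odd_iff.1 h]; rfl
    · rw [Nat.even_iff.1 (Nat.not_odd_iff_even.1 h)]; rfl
  rw [mirrorWord, h, List.reverse_replicate, ← List.replicate_add, ← List.replicate_add]
  congr 1
  omega

/-- The center of the image of a palindrome with center `c`. -/
def centerMap (t s : ℕ) : Option (Fin m) → Option (Fin m)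
  | none => blockCenter m t
  | some a => if h : (a : ℕ) + 1 < m then some ⟨a + 1, h⟩ else blockCenter m (t + s)

/-- The number of zeros following the center in the image of a palindrome with center `c`. -/
def centerPad (t s : ℕ) : Option (Fin m) → ℕ
  | none => t / 2
  | some a => if (a : ℕ) + 1 < m then t else (t + s) / 2

/-- The right half of the image of the palindrome with center `c` and right half `h`. -/
def halfMap (t s : ℕ) (c : Option (Fin m)) (h : List (Fin m)) : List (Fin m) :=
  List.replicate (centerPad t s c) 0 ++ applyMorphism (conjSubst t s) h

/-- Reversal exchanges φ and ψ, so the left half is coded by φ and the right half by ψ. The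
conjugacy moves the trailing 0^t to the middle, where φ(c)0^t is a palindrome for each of the three
kinds of center. -/
theorem mirrorWord_halfMap (t s : ℕ) (c : Option (Fin m)) (h : List (Fin m)) :
    mirrorWord (centerMap t s c) (halfMap t s c h) =
      applyMorphism (confluentSubst t s) (mirrorWord c h) ++ List.replicate t 0 := by
  have key : mirrorWord (centerMap t s c) (List.replicate (centerPad t s c) 0) =
      applyMorphism (confluentSubst t s) c.toList ++ List.replicate t 0 := by
    rcases c with _ | a
    · simp [centerMap, centerPad, ← replicate_eq_mirrorWord, applyMorphism_nil]
    · simp only [centerMap, centerPad, Option.toList_some, applyMorphism_singleton,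
        confluentSubst]
      split_ifs with h
      · simp [mirrorWord]
      · rw [← replicate_eq_mirrorWord, ← List.replicate_add, Nat.add_comm]
  calc mirrorWord (centerMap t s c) (halfMap t s c h)
      = applyMorphism (confluentSubst t s) h.reverse ++
          (mirrorWord (centerMap t s c) (List.replicate (centerPad t s c) 0) ++
            applyMorphism (conjSubst t s) h) := by
        rw [← reverse_applyMorphism_conjSubst]
        simp [mirrorWord, halfMap]
    _ = _ := by
        rw [key, List.append_assoc, ← applyMorphism_append_replicate]
        simp [mirrorWord, applyMorphism_append]

theorem halfMap_prefix (t s : ℕ) (c : Option (Fin m)) {h h' : List (Fin m)} (hh : h <+: h') :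
    halfMap t s c h <+: halfMap t s c h' := by
  obtain ⟨r, hr⟩ := applyMorphism_prefix (conjSubst t s) hh
  exact ⟨r, by rw [halfMap, halfMap, List.append_assoc, hr]⟩

theorem length_halfMap {t s : ℕ} (hs : 1 ≤ s) (c : Option (Fin m)) (h : List (Fin m)) :
    centerPad t s c + h.length ≤ (halfMap t s c h).length := by
  have := length_le_length_applyMorphism (one_le_length_conjSubst (t := t) hs) h
  simpa [halfMap] using this

end Substitution

/-! ### Zero runs and desubstitution in the fixed point -/

section FixedPoint

variable {m : ℕ} [NeZero m]

/-- `u` is the fixed point of the substitution with parameters `t ≥ s ≥ 1`. -/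
structure IsConfluentFixedPoint (t s : ℕ) (u : ℕ → Fin m) : Prop where
  two_le : 2 ≤ m
  one_le : 1 ≤ s
  le : s ≤ t
  map_zero : u 0 = 0
  fixed : ∀ r, IsInitial u (applyMorphism (confluentSubst t s) ((List.range r).map u))

/-- The position at which the image of the letter `u r` begins in `u`. -/
def cut (t s : ℕ) (u : ℕ → Fin m) (r : ℕ) : ℕ :=
  (applyMorphism (confluentSubst t s) ((List.range r).map u)).length

/-- A run of exactly `n` zeros begins at position `p` of `v`. -/
def HasRun (v : ℕ → Fin m) (p n : ℕ) : Prop := (∀ i < n, v (p + i) = 0) ∧ v (p + n) ≠ 0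

theorem HasRun.unique {v : ℕ → Fin m} {p n n' : ℕ} (h : HasRun v p n) (h' : HasRun v p n') :
    n = n' := by
  rcases lt_trichotomy n n' with hlt | heq | hlt
  · exact absurd (h'.1 n hlt) h.2
  · exact heq
  · exact absurd (h.1 n' hlt) h'.2

theorem cut_succ (t s : ℕ) (u : ℕ → Fin m) (r : ℕ) :
    cut t s u (r + 1) = cut t s u r + (confluentSubst t s (u r)).length := by
  rw [cut, map_range_succ, applyMorphism_append, applyMorphism_singleton, List.length_append, cut]

variable {t s : ℕ} {u : ℕ → Fin m}

namespace IsConfluentFixedPoint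

theorem isInitial_block (hu : IsConfluentFixedPoint t s u) (r : ℕ) :
    IsInitial (fun j => u (cut t s u r + j)) (confluentSubst t s (u r)) := by
  have := hu.fixed (r + 1)
  rw [map_range_succ, applyMorphism_append, applyMorphism_singleton, isInitial_append] at this
  exact this.2

theorem le_cut (hu : IsConfluentFixedPoint t s u) (r : ℕ) : r ≤ cut t s u r := by
  simpa [cut] using length_le_length_applyMorphism
    (one_le_length_confluentSubst (t := t) hu.one_le) ((List.range r).map u)

theorem hasRun_of_lt (hu : IsConfluentFixedPoint t s u) {r : ℕ} (hr : (u r : ℕ) + 1 < m) :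
    HasRun u (cut t s u r) t ∧ cut t s u (r + 1) = cut t s u r + t + 1 := by
  have h := hu.isInitial_block r
  rw [cut_succ]
  rw [confluentSubst, dif_pos hr] at h ⊢
  rw [isInitial_append, isInitial_replicate, isInitial_singleton] at h
  obtain ⟨h1, h2⟩ := h
  simp only [List.length_replicate, Nat.add_zero] at h2
  refine ⟨⟨h1, ?_⟩, by simp; omega⟩
  rw [h2]
  intro h0
  simpa using congrArg Fin.val h0

theorem zeros_of_not_lt (hu : IsConfluentFixedPoint t s u) {r : ℕ} (hr : ¬ (u r : ℕ) + 1 < m) :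
    (∀ i < s, u (cut t s u r + i) = 0) ∧ cut t s u (r + 1) = cut t s u r + s := by
  have h := hu.isInitial_block r
  rw [cut_succ]
  rw [confluentSubst, dif_neg hr] at h ⊢
  rw [isInitial_replicate] at h
  exact ⟨h, by simp⟩

theorem apply_cut (hu : IsConfluentFixedPoint t s u) (r : ℕ) : u (cut t s u r) = 0 := by
  have h1 := hu.one_le
  have h2 := hu.le
  by_cases hr : (u r : ℕ) + 1 < m
  · exact (hu.hasRun_of_lt hr).1.1 0 (by omega)
  · exact (hu.zeros_of_not_lt hr).1 0 (by omega)

/-- A nonzero letter can only be the last letter of an image, so the next image starts right after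
it. -/
theorem exists_cut_eq (hu : IsConfluentFixedPoint t s u) {j : ℕ} (hj : u j ≠ 0) :
    ∃ r, j + 1 = cut t s u r := by
  have key : ∀ r, j < cut t s u r → ∃ r', j + 1 = cut t s u r' := by
    intro r
    induction r with
    | zero => intro h; simp [cut, applyMorphism] at h
    | succ r ih =>
      intro h
      by_cases hlt : j < cut t s u r
      · exact ih hlt
      · obtain ⟨d, rfl⟩ := Nat.exists_eq_add_of_le (not_lt.1 hlt)
        by_cases hr : (u r : ℕ) + 1 < m
        · obtain ⟨⟨h1, _⟩, h2⟩ := hu.hasRun_of_lt hr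
          have : ¬ d < t := fun hd => hj (h1 d hd)
          exact ⟨r + 1, by omega⟩
        · obtain ⟨h1, h2⟩ := hu.zeros_of_not_lt hr
          exact absurd (h1 d (by omega)) hj
  exact key (j + 1) (hu.le_cut (j + 1))

/-- No two consecutive letters of `u` are nonzero. -/
theorem apply_succ_eq_zero (hu : IsConfluentFixedPoint t s u) {j : ℕ} (hj : u j ≠ 0) :
    u (j + 1) = 0 := by
  obtain ⟨r, hr⟩ := hu.exists_cut_eq hj
  rw [hr, hu.apply_cut]

/-- The image 0^s of m-1 is followed by the image 0^t 1 of 0, since nonzero letters are isolated;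
this merges into a run of t+s zeros. -/
theorem hasRun_cut (hu : IsConfluentFixedPoint t s u) (r : ℕ) :
    HasRun u (cut t s u r) t ∨ HasRun u (cut t s u r) (t + s) := by
  have hm := hu.two_le
  by_cases hr : (u r : ℕ) + 1 < m
  · exact Or.inl (hu.hasRun_of_lt hr).1
  · right
    obtain ⟨h1, h2⟩ := hu.zeros_of_not_lt hr
    have h0 : u (r + 1) = 0 := by
      apply hu.apply_succ_eq_zero
      intro h
      rw [h] at hr
      simp at hr
      omega
    obtain ⟨⟨h3, h4⟩, _⟩ := hu.hasRun_of_lt (r := r + 1) (by rw [h0]; simp; omega)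
    rw [h2] at h3 h4
    refine ⟨fun i hi => ?_, by rwa [Nat.add_comm t s, ← Nat.add_assoc]⟩
    by_cases his : i < s
    · exact h1 i his
    · have := h3 (i - s) (by omega)
      rwa [show cut t s u r + s + (i - s) = cut t s u r + i by omega] at this

theorem hasRun_succ (hu : IsConfluentFixedPoint t s u) {j : ℕ} (hj : u j ≠ 0) :
    HasRun u (j + 1) t ∨ HasRun u (j + 1) (t + s) := by
  obtain ⟨r, hr⟩ := hu.exists_cut_eq hj
  rw [hr]
  exact hu.hasRun_cut r

theorem exists_ne_zero (hu : IsConfluentFixedPoint t s u) (j : ℕ) :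
    ∃ i ≤ t + s + 1, u (j + i) ≠ 0 := by
  induction j with
  | zero =>
    have hm := hu.two_le
    have := (hu.hasRun_of_lt (r := 0) (by rw [hu.map_zero]; simp; omega)).1.2
    refine ⟨t, by omega, ?_⟩
    simpa [cut, applyMorphism] using this
  | succ j ih =>
    obtain ⟨i, hi, h⟩ := ih
    rcases i with _ | i
    · rcases hu.hasRun_succ h with h' | h'
      · exact ⟨t, by omega, h'.2⟩
      · exact ⟨t + s, by omega, h'.2⟩
    · exact ⟨i, by omega, by rwa [Nat.add_right_comm, Nat.add_assoc]⟩

/-- The extra 0^t is always available: the image that follows lies at a cut, where at least t zeros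
begin. -/
theorem isFactor_image (hu : IsConfluentFixedPoint t s u) {w : List (Fin m)}
    (hw : IsFactor u w) :
    IsFactor u (applyMorphism (confluentSubst t s) w ++ List.replicate t 0) := by
  obtain ⟨k, hk⟩ := isFactor_iff.1 hw
  have hpre : (List.range (k + w.length)).map u = (List.range k).map u ++ w := by
    rw [List.range_add, List.map_append, List.map_map]
    congr 1
    exact hk.symm
  have h := hu.fixed (k + w.length)
  have hcut : cut t s u (k + w.length) =
      cut t s u k + (applyMorphism (confluentSubst t s) w).length := by
    rw [cut, hpre, applyMorphism_append, List.length_append, cut]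
  rw [hpre, applyMorphism_append, isInitial_append] at h
  refine isFactor_iff.2 ⟨cut t s u k, ?_⟩
  rw [isInitial_append, isInitial_replicate]
  refine ⟨h.2, fun j hj => ?_⟩
  rw [← Nat.add_assoc, ← hcut]
  rcases hu.hasRun_cut (k + w.length) with h' | h'
  · exact h'.1 j hj
  · exact h'.1 j (by omega)

/-- As a < m-1, the image ends in a nonzero letter, which forces its occurrence to end at a cut. The
suffix code property then decodes it leftwards from there. -/
theorem isFactor_of_image (hu : IsConfluentFixedPoint t s u) {w : List (Fin m)} {a : Fin m}
    (ha : (a : ℕ) + 1 < m)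
    (hw : IsFactor u (applyMorphism (confluentSubst t s) (w ++ [a]))) : IsFactor u (w ++ [a]) := by
  obtain ⟨k, hk⟩ := isFactor_iff.1 hw
  have hk' := hk
  rw [applyMorphism_append, applyMorphism_singleton, confluentSubst, dif_pos ha,
    ← List.append_assoc, isInitial_append, isInitial_singleton] at hk'
  have hne : u (k + ((applyMorphism (confluentSubst t s) w ++
      List.replicate t 0).length + 0)) ≠ 0 := by
    rw [hk'.2]
    intro h0
    simpa using congrArg Fin.val h0
  obtain ⟨r, hr⟩ := hu.exists_cut_eq hne
  have hlen : cut t s u r = k + (applyMorphism (confluentSubst t s) (w ++ [a])).length := by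
    rw [← hr, applyMorphism_append, applyMorphism_singleton, confluentSubst, dif_pos ha]
    simp
    omega
  have hsuf : applyMorphism (confluentSubst t s) (w ++ [a]) <:+
      applyMorphism (confluentSubst t s) ((List.range r).map u) := by
    refine ⟨(List.range k).map u, ?_⟩
    have h1 := hu.fixed r
    rw [IsInitial, ← cut, hlen] at h1
    rw [h1, List.range_add, List.map_append, List.map_map]
    congr 1
  have h2 := suffix_of_applyMorphism_suffix hu.one_le _ _ hsuf
  refine IsFactor.of_infix (w := (List.range r).map u) ?_ h2.isInfix
  exact isFactor_iff.2 ⟨0, by simpa using isInitial_range u r⟩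

theorem isFactor_mirrorWord_halfMap (hu : IsConfluentFixedPoint t s u) {c : Option (Fin m)}
    {h : List (Fin m)} (hh : IsFactor u (mirrorWord c h)) :
    IsFactor u (mirrorWord (centerMap t s c) (halfMap t s c h)) := by
  rw [mirrorWord_halfMap]
  exact hu.isFactor_image hh

end IsConfluentFixedPoint

end FixedPoint

/-! ### Desubstitution of branches and uniqueness -/

section Branches

variable {m : ℕ} [NeZero m] {t s : ℕ} {u : ℕ → Fin m}

/-- An image of a letter under the conjugate substitution can be read in `v` from position `p`. -/
def IsReadable (s : ℕ) (v : ℕ → Fin m) (p : ℕ) : Prop := v p ≠ 0 ∨ HasRun v p s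

/-- Unique decoding of an infinite word along the conjugate substitution. -/
theorem exists_decoding (hm : 2 ≤ m) (hs : 1 ≤ s) {v : ℕ → Fin m}
    (hv : ∀ j, v j ≠ 0 → HasRun v (j + 1) t ∨ HasRun v (j + 1) (t + s)) {q : ℕ}
    (hq : IsReadable s v q) :
    ∃ v' : ℕ → Fin m, ∀ n,
      IsInitial (fun j => v (q + j))
        (applyMorphism (conjSubst t s) ((List.range n).map v')) ∧
      ((v' n : ℕ) + 1 < m ∨ (v' (n + 1) : ℕ) + 1 < m) := by
  choose g hg₁ hg₂ using exists_conjSubst_eq (m := m) hm t s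
  -- `p n` is the position where the n-th decoded image starts; the letter found there selects the
  -- image.
  let p : ℕ → ℕ := fun n => n.rec q fun _ x => x + (conjSubst t s (g (v x))).length
  have hp0 : p 0 = q := rfl
  have hpsucc : ∀ n, p (n + 1) = p n + (conjSubst t s (g (v (p n)))).length := fun _ => rfl
  -- After a nonzero letter and t zeros comes either a nonzero letter or exactly s more zeros, the
  -- image of m-1. A run of exactly s zeros ends at a nonzero letter, so m-1 is never decoded twice
  -- in succession.
  have hread : ∀ x, IsReadable s v x →
      IsReadable s v (x + (conjSubst t s (g (v x))).length) ∧
      IsInitial (fun j => v (x + j)) (conjSubst t s (g (v x))) ∧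
      (v x ≠ 0 ∨ v (x + (conjSubst t s (g (v x))).length) ≠ 0) := by
    intro x hx
    rw [hg₂]
    by_cases h0 : v x = 0
    · have hrun := hx.resolve_left (not_not.2 h0)
      rw [if_pos h0, List.length_replicate, isInitial_replicate]
      exact ⟨Or.inl hrun.2, hrun.1, Or.inr hrun.2⟩
    · rw [if_neg h0, List.length_cons, List.length_replicate,
        show v x :: List.replicate t (0 : Fin m) = [v x] ++ List.replicate t 0 from rfl,
        isInitial_append, isInitial_singleton, isInitial_replicate]
      rw [show x + (t + 1) = x + 1 + t by omega]
      simp only [← Nat.add_assoc, Nat.add_zero, List.length_singleton, true_and]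
      rcases hv x h0 with h | h
      · exact ⟨Or.inl h.2, h.1, Or.inl h0⟩
      · refine ⟨Or.inr ⟨fun i hi => ?_, ?_⟩, fun i hi => h.1 i (by omega), Or.inl h0⟩
        · rw [Nat.add_assoc (x + 1)]
          exact h.1 _ (by omega)
        · rw [Nat.add_assoc (x + 1)]
          exact h.2
  have hreadp : ∀ n, IsReadable s v (p n) := by
    intro n
    induction n with
    | zero => exact hq
    | succ n ih => exact (hread _ ih).1
  refine ⟨fun n => g (v (p n)), fun n => ⟨?_, ?_⟩⟩
  · have hlen : ∀ n, p n = q + (applyMorphism (conjSubst t s)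
        ((List.range n).map fun n => g (v (p n)))).length := by
      intro n
      induction n with
      | zero => simp [hp0, applyMorphism]
      | succ n ih =>
        rw [hpsucc, map_range_succ, applyMorphism_append, List.length_append, ← Nat.add_assoc,
          ← ih, applyMorphism_singleton]
    induction n with
    | zero => simp [applyMorphism, IsInitial]
    | succ n ih =>
      rw [map_range_succ, applyMorphism_append, isInitial_append, applyMorphism_singleton]
      refine ⟨ih, ?_⟩
      simp only [← Nat.add_assoc, ← hlen]
      exact (hread _ (hreadp n)).2.1
  · simp only [hg₁]
    exact (hread _ (hreadp n)).2.2

theorem hasRun_congr {v w : ℕ → Fin m} {p q n : ℕ} (h : ∀ i ≤ n, v (p + i) = w (q + i)) :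
    HasRun v p n ↔ HasRun w q n := by
  unfold HasRun
  rw [h n le_rfl]
  exact and_congr_left fun _ => forall₂_congr fun i hi => by rw [h i hi.le]

theorem hasRun_half (hu : IsConfluentFixedPoint t s u) {c : Option (Fin m)} {v : ℕ → Fin m}
    (hv : IsBranchHalf u c v) {j : ℕ} (hj : v j ≠ 0) :
    HasRun v (j + 1) t ∨ HasRun v (j + 1) (t + s) := by
  obtain ⟨k, -, -, hk⟩ := hv.exists_occurrence (j + 1 + (t + s) + 1)
  set K := k + (j + 1 + (t + s) + 1 + c.toList.length)
  have h := hu.hasRun_succ (j := K + j) (by rwa [hk j (by omega)])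
  refine h.imp (fun h => ?_) (fun h => ?_) <;>
  · refine (hasRun_congr fun i hi => ?_).1 h
    rw [Nat.add_assoc K, Nat.add_assoc K, hk _ (by omega)]

theorem exists_ne_zero_half (hu : IsConfluentFixedPoint t s u) {c : Option (Fin m)}
    {v : ℕ → Fin m} (hv : IsBranchHalf u c v) : ∃ i, v i ≠ 0 := by
  obtain ⟨k, -, -, hk⟩ := hv.exists_occurrence (t + s + 2)
  obtain ⟨i, hi, h⟩ := hu.exists_ne_zero (k + (t + s + 2 + c.toList.length))
  exact ⟨i, by rwa [hk i (by omega)] at h⟩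

/-- A central block of zeros arises from the empty center or from the last letter. -/
theorem exists_center_of_zero (hu : IsConfluentFixedPoint t s u) {c : Option (Fin m)}
    {v : ℕ → Fin m} (hv : IsBranchHalf u c v) (hc : ∀ a, c = some a → a = 0) :
    ∃ c' : Option (Fin m), centerMap t s c' = c ∧ (∀ j < centerPad t s c', v j = 0) ∧
      IsReadable s v (centerPad t s c') := by
  classical
  have hm := hu.two_le
  have hex := exists_ne_zero_half hu hv
  obtain ⟨i, hi⟩ : ∃ i, i = Nat.find hex := ⟨_, rfl⟩
  have hne : v i ≠ 0 := hi ▸ Nat.find_spec hex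
  have hzero : ∀ j < i, v j = 0 := fun j hj => not_not.1 (Nat.find_min hex (hi ▸ hj))
  obtain ⟨k, hk1, hk2, hk3⟩ := hv.exists_occurrence (i + 1)
  have hlen : c.toList.length ≤ 1 := by cases c <;> simp
  -- The central zero block has length 2i + |c|, whose parity determines c.
  have hcc : c = blockCenter m (2 * i + c.toList.length) := by
    rcases c with _ | a
    · simp [blockCenter]
    · simp [blockCenter, hc a rfl]
  have hleft := hk1 i (by omega)
  simp only [Nat.add_sub_cancel, Nat.sub_self, Nat.add_zero] at hleft
  -- Radius i+1 exposes the nonzero letter `v i` on both sides, so the block is a maximal run and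
  -- its length must be t or t+s.
  have hrun : HasRun u (k + 1) (2 * i + c.toList.length) := by
    constructor
    · intro j hj
      rcases lt_or_ge j i with h | h
      · have := hk1 (i - 1 - j) (by omega)
        rw [hzero _ (by omega)] at this
        rw [← this]
        congr 1
        omega
      · rcases lt_or_ge j (i + c.toList.length) with h' | h'
        · rcases c with _ | a
          · simp at h'
            omega
          · have hj' : j = i := by simp at h'; omega
            rw [hj', Nat.add_assoc, Nat.add_comm 1 i, hk2 a rfl, hc a rfl]
        · have := hk3 (j - i - c.toList.length) (by omega)
          rw [hzero _ (by omega)] at this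
          rw [← this]
          congr 1
          omega
    · have := hk3 i (by omega)
      rw [← this] at hne
      convert hne using 2
      omega
  rcases hu.hasRun_succ (hleft ▸ hne) with h | h
  · have he := hrun.unique h
    have hpad : centerPad t s (none : Option (Fin m)) = i := by simp only [centerPad]; omega
    refine ⟨none, ?_, ?_, ?_⟩
    · rw [hcc, he]; rfl
    · rwa [hpad]
    · rw [hpad]; exact Or.inl hne
  · have he := hrun.unique h
    have hlast : ¬ ((⟨m - 1, by omega⟩ : Fin m) : ℕ) + 1 < m := by simp only; omega
    have hpad : centerPad t s (some (⟨m - 1, by omega⟩ : Fin m)) = i := by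
      rw [centerPad, if_neg hlast]; omega
    refine ⟨some ⟨m - 1, by omega⟩, ?_, ?_, ?_⟩
    · rw [centerMap, dif_neg hlast, hcc, he]
    · rwa [hpad]
    · rw [hpad]; exact Or.inl hne

/-- The central letter a closes the image of a-1. Of the t or t+s zeros after it, t form the pad;
any remaining s are the image of m-1. -/
theorem exists_center_of_ne_zero (hu : IsConfluentFixedPoint t s u) {a : Fin m}
    {v : ℕ → Fin m} (hv : IsBranchHalf u (some a) v) (ha : a ≠ 0) :
    ∃ c' : Option (Fin m), centerMap t s c' = some a ∧ (∀ j < centerPad t s c', v j = 0) ∧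
      IsReadable s v (centerPad t s c') := by
  have ha' : (a : ℕ) ≠ 0 := fun h => ha (Fin.ext h)
  have hlt := a.isLt
  have hpred : ((⟨a - 1, by omega⟩ : Fin m) : ℕ) + 1 < m := by simp only; omega
  refine ⟨some ⟨a - 1, by omega⟩, ?_, ?_⟩
  · rw [centerMap, dif_pos hpred]
    congr 1
    apply Fin.ext
    simp only
    omega
  · rw [centerPad, if_pos hpred]
    obtain ⟨k, -, hk2, hk3⟩ := hv.exists_occurrence (t + s + 1)
    simp only [Option.toList_some, List.length_singleton, ← Nat.add_assoc] at hk3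
    have hne : u (k + (t + s + 1)) ≠ 0 := by rwa [hk2 a rfl]
    rcases hu.hasRun_succ hne with h | h
    · have h' : HasRun v 0 t := by
        refine (hasRun_congr fun i hi => ?_).1 h
        rw [← hk3 (0 + i) (by omega)]
        congr 1
        omega
      simp only [HasRun, Nat.zero_add] at h'
      exact ⟨h'.1, Or.inl h'.2⟩
    · have h' : HasRun v 0 (t + s) := by
        refine (hasRun_congr fun i hi => ?_).1 h
        rw [← hk3 (0 + i) (by omega)]
        congr 1
        omega
      simp only [HasRun, Nat.zero_add] at h'
      exact ⟨fun j hj => h'.1 j (by omega), Or.inr ⟨fun j hj => h'.1 _ (by omega), h'.2⟩⟩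

/-- Every infinite palindromic branch is the image of an infinite palindromic branch. -/
theorem exists_preimage_branch (hu : IsConfluentFixedPoint t s u) {c : Option (Fin m)}
    {v : ℕ → Fin m} (hv : IsBranchHalf u c v) :
    ∃ c' v', centerMap t s c' = c ∧ IsBranchHalf u c' v' ∧
      ∀ n, IsInitial v (halfMap t s c' ((List.range n).map v')) := by
  obtain ⟨c', hc', hzero, hread⟩ : ∃ c' : Option (Fin m), centerMap t s c' = c ∧
      (∀ j < centerPad t s c', v j = 0) ∧ IsReadable s v (centerPad t s c') := by
    by_cases hc : ∀ a, c = some a → a = 0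
    · exact exists_center_of_zero hu hv hc
    · push Not at hc
      obtain ⟨a, rfl, ha⟩ := hc
      exact exists_center_of_ne_zero hu hv ha
  obtain ⟨v', hv'⟩ := exists_decoding hu.two_le hu.one_le (fun j hj => hasRun_half hu hv hj) hread
  have hinit : ∀ n, IsInitial v (halfMap t s c' ((List.range n).map v')) := by
    intro n
    rw [halfMap, isInitial_append, isInitial_replicate, List.length_replicate]
    exact ⟨hzero, (hv' n).1⟩
  -- Only halves ending in a letter below m-1 are desubstituted directly; of two consecutive decoded
  -- letters at least one is such, and shorter halves are inner factors.
  have hfac : ∀ n, (v' n : ℕ) + 1 < m → IsFactor u (centralWord c' v' (n + 1)) := by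
    intro n hn
    have h1 := hv (halfMap t s c' ((List.range (n + 1)).map v')).length
    rw [centralWord_eq, ← hinit (n + 1), ← hc', mirrorWord_halfMap] at h1
    have h2 := h1.of_infix (List.prefix_append _ _).isInfix
    rw [centralWord_eq]
    have h3 : mirrorWord c' ((List.range (n + 1)).map v') =
        ((List.range (n + 1)).map v').reverse ++ c'.toList ++ (List.range n).map v' ++ [v' n] := by
      rw [mirrorWord, List.append_assoc _ _ [v' n], ← map_range_succ]
    rw [h3] at h2 ⊢
    exact hu.isFactor_of_image hn h2
  refine ⟨c', v', hc', fun n => ?_, hinit⟩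
  rcases (hv' n).2 with h | h
  · exact (hfac n h).of_infix (mirrorWord_infix c' (map_range_prefix v' (by omega)))
  · exact (hfac (n + 1) h).of_infix (mirrorWord_infix c' (map_range_prefix v' (by omega)))

/-- Uniqueness of branches when centers of branches have unique preimages. -/
theorem isBranchHalf_unique (hu : IsConfluentFixedPoint t s u)
    (hinj : ∀ (c₁ c₂ : Option (Fin m)) (v₁ v₂ : ℕ → Fin m), IsBranchHalf u c₁ v₁ →
      IsBranchHalf u c₂ v₂ → centerMap t s c₁ = centerMap t s c₂ → c₁ = c₂)
    {c : Option (Fin m)} {v w : ℕ → Fin m} (hv : IsBranchHalf u c v) (hw : IsBranchHalf u c w) :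
    v = w := by
  have hs := hu.one_le
  have hle := hu.le
  have step : ∀ {c v w}, IsBranchHalf u c v → IsBranchHalf u c w →
      ∃ (c' : Option (Fin m)) (v' w' : ℕ → Fin m), centerMap t s c' = c ∧
        IsBranchHalf u c' v' ∧ IsBranchHalf u c' w' ∧
        -- The common pad is a gain in agreement on top of the images of N common letters, each of
        -- length at least 1.
        ∀ N, (∀ i < N, v' i = w' i) → ∀ i < centerPad t s c' + N, v i = w i := by
    intro c v w hv hw
    obtain ⟨c₁, v', h1, hv', hv2⟩ := exists_preimage_branch hu hv
    obtain ⟨c₂, w', h2, hw', hw2⟩ := exists_preimage_branch hu hw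
    obtain rfl := hinj c₁ c₂ v' w' hv' hw' (h1.trans h2.symm)
    refine ⟨c₁, v', w', h1, hv', hw', fun N hN i hi => ?_⟩
    have hlen := length_halfMap (t := t) hs c₁ ((List.range N).map v')
    rw [List.length_map, List.length_range] at hlen
    have e1 := (hv2 N).getElem (i := i) (by omega)
    have hw3 := hw2 N
    rw [← map_range_congr hN] at hw3
    rw [← e1, hw3.getElem]
  have hpos : ∀ a : Fin m, 1 ≤ centerPad t s (some a) := by
    intro a
    simp only [centerPad]
    split_ifs <;> omega
  have key : ∀ N, ∀ c v w, IsBranchHalf u c v → IsBranchHalf u c w → ∀ i < N, v i = w i := by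
    intro N
    induction N with
    | zero => intro c v w _ _ i hi; omega
    | succ N ih =>
      have grow : ∀ {c' : Option (Fin m)}, 1 ≤ centerPad t s c' → ∀ {v w v' w' : ℕ → Fin m},
          IsBranchHalf u c' v' → IsBranchHalf u c' w' →
          (∀ N, (∀ i < N, v' i = w' i) → ∀ i < centerPad t s c' + N, v i = w i) →
          ∀ i < N + 1, v i = w i := by
        intro c' hc' v w v' w' hv' hw' h i hi
        exact h N (ih c' v' w' hv' hw') i (by omega)
      intro c v w hv hw
      obtain ⟨c', v', w', hc', hv', hw', h⟩ := step hv hw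
      by_cases hpad : 1 ≤ centerPad t s c'
      · exact grow hpad hv' hw' h
      -- The pad vanishes only for center ε with t = 1. As ε then maps to 0, one further
      -- desubstitution of ε leads to a letter, whose pad is positive.
      · obtain rfl : c' = none := by
          rcases c' with _ | a
          · rfl
          · exact absurd (hpos a) hpad
        have ht : t = 1 := by
          simp only [centerPad] at hpad
          omega
        obtain ⟨c'', v'', w'', hc'', hv'', hw'', h'⟩ := step hv' hw'
        rcases c'' with _ | a
        · simp [centerMap, blockCenter, ht] at hc''
        · intro i hi
          exact h (N + 1) (grow (hpos a) hv'' hw'' h') i (by omega)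
  funext i
  exact key (i + 1) c v w hv hw i (by omega)

/-! ### Existence of branches from periodic centers -/

/-- Arbitrarily long nested palindromic factors with a common center. -/
def HasPalindromicChain {A : Type*} (u : ℕ → A) (c : Option A) : Prop :=
  ∃ h : ℕ → List A, (∀ k, h k <+: h (k + 1)) ∧ (∀ k, k ≤ (h k).length) ∧
    ∀ k, IsFactor u (mirrorWord c (h k))

theorem HasPalindromicChain.exists_isBranchHalf {A : Type*} {u : ℕ → A} {c : Option A}
    (h : HasPalindromicChain u c) : ∃ v, IsBranchHalf u c v := by
  obtain ⟨h, h1, h2, h3⟩ := h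
  exact exists_isBranchHalf_of_chain h1 h2 h3

theorem HasPalindromicChain.image (hu : IsConfluentFixedPoint t s u) {c : Option (Fin m)}
    (h : HasPalindromicChain u c) : HasPalindromicChain u (centerMap t s c) := by
  obtain ⟨h, h1, h2, h3⟩ := h
  refine ⟨fun k => halfMap t s c (h k), fun k => halfMap_prefix t s c (h1 k), fun k => ?_,
    fun k => hu.isFactor_mirrorWord_halfMap (h3 k)⟩
  exact (h2 k).trans ((Nat.le_add_left _ _).trans (length_halfMap hu.one_le c (h k)))

theorem HasPalindromicChain.iterate (hu : IsConfluentFixedPoint t s u) {c : Option (Fin m)}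
    (h : HasPalindromicChain u c) (n : ℕ) : HasPalindromicChain u ((centerMap t s)^[n] c) := by
  induction n with
  | zero => exact h
  | succ n ih =>
    rw [Function.iterate_succ_apply']
    exact ih.image hu

/-- Half of the `n`-fold image of the palindrome with center `c` and right half `h`. -/
def iterHalf (t s : ℕ) : ℕ → Option (Fin m) → List (Fin m) → List (Fin m)
  | 0, _, h => h
  | n + 1, c, h => iterHalf t s n (centerMap t s c) (halfMap t s c h)

theorem iterHalf_prefix (t s n : ℕ) (c : Option (Fin m)) {h h' : List (Fin m)} (hh : h <+: h') :
    iterHalf t s n c h <+: iterHalf t s n c h' := by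
  induction n generalizing c h h' with
  | zero => exact hh
  | succ n ih => exact ih _ (halfMap_prefix t s c hh)

theorem length_iterHalf (hs : 1 ≤ s) (n : ℕ) (c : Option (Fin m)) (h : List (Fin m)) :
    h.length ≤ (iterHalf t s n c h).length := by
  induction n generalizing c h with
  | zero => exact le_rfl
  | succ n ih =>
    have := length_halfMap (t := t) hs c h
    exact le_trans (by omega) (ih (centerMap t s c) (halfMap t s c h))

theorem isFactor_iterHalf (hu : IsConfluentFixedPoint t s u) (n : ℕ) {c : Option (Fin m)}
    {h : List (Fin m)} (hh : IsFactor u (mirrorWord c h)) :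
    IsFactor u (mirrorWord ((centerMap t s)^[n] c) (iterHalf t s n c h)) := by
  induction n generalizing c h with
  | zero => exact hh
  | succ n ih => exact ih (hu.isFactor_mirrorWord_halfMap hh)

/-- A periodic center that occurs in `u` carries arbitrarily long palindromes. -/
theorem hasPalindromicChain_of_periodic (hu : IsConfluentFixedPoint t s u)
    {c : Option (Fin m)} (hc : IsFactor u c.toList) (hpad : 1 ≤ centerPad t s c) {n : ℕ}
    (hn : (centerMap t s)^[n + 1] c = c) : HasPalindromicChain u c := by
  have hs := hu.one_le
  -- Start from the bare center. Each full period restores c and lengthens the half by at least the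
  -- pad of c, while the other steps never shorten it.
  refine ⟨fun k => (iterHalf t s (n + 1) c)^[k] [], fun k => ?_, fun k => ?_, fun k => ?_⟩
  · induction k with
    | zero => exact List.nil_prefix
    | succ k ih =>
      simp only at ih ⊢
      rw [Function.iterate_succ_apply', Function.iterate_succ_apply']
      exact iterHalf_prefix t s (n + 1) c ih
  · induction k with
    | zero => simp
    | succ k ih =>
      simp only [Function.iterate_succ_apply'] at ih ⊢
      set h := (iterHalf t s (n + 1) c)^[k] []
      have h1 := length_halfMap (t := t) hs c h
      have h2 := length_iterHalf (t := t) hs n (centerMap t s c) (halfMap t s c h)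
      simp only [iterHalf]
      omega
  · induction k with
    | zero => simpa [mirrorWord] using hc
    | succ k ih =>
      simp only [Function.iterate_succ_apply']
      have := isFactor_iterHalf hu (n + 1) ih
      rwa [hn] at this

theorem iterate_centerMap_zero (t s : ℕ) {k : ℕ} (hk : k < m) :
    (centerMap t s)^[k] (some (0 : Fin m)) = some ⟨k, hk⟩ := by
  induction k with
  | zero => rfl
  | succ k ih =>
    rw [Function.iterate_succ_apply', ih (by omega), centerMap, dif_pos hk]

theorem iterate_centerMap_length (t s : ℕ) :
    (centerMap t s)^[m] (some (0 : Fin m)) = blockCenter m (t + s) := by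
  have hm := NeZero.pos m
  obtain ⟨k, hk⟩ := Nat.exists_eq_add_of_le' hm
  have hlt : k < m := by omega
  have hstep : (centerMap t s)^[m] (some (0 : Fin m)) = (centerMap t s)^[k + 1] (some 0) :=
    congrArg (fun n => (centerMap t s)^[n] (some (0 : Fin m))) hk
  rw [hstep, Function.iterate_succ_apply', iterate_centerMap_zero t s hlt, centerMap,
    dif_neg (by simp only; omega)]

theorem hasPalindromicChain_some (hu : IsConfluentFixedPoint t s u)
    (h : HasPalindromicChain u (some (0 : Fin m))) (a : Fin m) :
    HasPalindromicChain u (some a) := by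
  rw [← iterate_centerMap_zero t s a.isLt]
  exact h.iterate hu a

theorem isFactor_zero (hu : IsConfluentFixedPoint t s u) :
    IsFactor u (some (0 : Fin m)).toList :=
  isFactor_iff.2 ⟨0, isInitial_singleton.2 hu.map_zero⟩

theorem hasPalindromicChain_zero (hu : IsConfluentFixedPoint t s u) {n : ℕ}
    (hn : (centerMap t s)^[n + 1] (some 0) = some (0 : Fin m)) :
    HasPalindromicChain u (some (0 : Fin m)) := by
  refine hasPalindromicChain_of_periodic hu (isFactor_zero hu) ?_ hn
  have h1 := hu.one_le
  have h2 := hu.le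
  simp only [centerPad]
  split_ifs <;> omega

/-- For t+s odd, m-1 returns to 0, so the letters form an m-cycle. -/
theorem hasPalindromicChain_some_of_odd (hu : IsConfluentFixedPoint t s u) (h : Odd (t + s))
    (a : Fin m) : HasPalindromicChain u (some a) := by
  obtain ⟨n, hn⟩ := Nat.exists_eq_add_of_le' (NeZero.pos m)
  refine hasPalindromicChain_some hu (hasPalindromicChain_zero hu (n := n) ?_) a
  have := iterate_centerMap_length (m := m) t s
  rw [blockCenter, if_pos h] at this
  rwa [← hn]

/-- The center ε is fixed, and its pad t/2 is positive because t is even and at least 1. -/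
theorem hasPalindromicChain_none_of_even (hu : IsConfluentFixedPoint t s u) (h : Even t) :
    HasPalindromicChain u none := by
  have h1 := hu.one_le
  have h2 := hu.le
  refine hasPalindromicChain_of_periodic hu (n := 0) ?_ ?_ ?_
  · exact isFactor_iff.2 ⟨0, rfl⟩
  · obtain ⟨r, rfl⟩ := h
    simp only [centerPad]
    omega
  · simp [centerMap, blockCenter, h]

/-! ### Dynamics of the centers and the three parity cases -/

theorem blockCenter_ne_some {n : ℕ} {b : Fin m} (hb : (b : ℕ) ≠ 0) :
    blockCenter m n ≠ some b := by
  unfold blockCenter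
  split_ifs
  · intro h
    rw [← Option.some.inj h] at hb
    simp at hb
  · simp

theorem centerMap_some_inj {a b : Fin m} (h : centerMap t s (some a) = centerMap t s (some b)) :
    a = b := by
  have hla := a.isLt
  have hlb := b.isLt
  apply Fin.ext
  simp only [centerMap] at h
  by_cases ha : (a : ℕ) + 1 < m <;> by_cases hb : (b : ℕ) + 1 < m
  · rw [dif_pos ha, dif_pos hb] at h
    simpa using h
  · rw [dif_pos ha, dif_neg hb] at h
    exact absurd h.symm (blockCenter_ne_some (Nat.succ_ne_zero _))
  · rw [dif_neg ha, dif_pos hb] at h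
    exact absurd h (blockCenter_ne_some (Nat.succ_ne_zero _))
  · omega

/-- The only possible collision is between m-1 and ε, and for s odd the block lengths t+s and t
differ in parity. -/
theorem centerMap_injective (hs : Odd s) :
    Function.Injective (centerMap t s : Option (Fin m) → Option (Fin m)) := by
  have key : ∀ a : Fin m, centerMap t s (some a) ≠ centerMap t s none := by
    intro a h
    simp only [centerMap] at h
    by_cases ha : (a : ℕ) + 1 < m
    · rw [dif_pos ha] at h
      exact blockCenter_ne_some (Nat.succ_ne_zero _) h.symm
    · rw [dif_neg ha] at h
      rcases Nat.even_or_odd t with ht | ht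
      · rw [blockCenter, blockCenter, if_pos (ht.add_odd hs),
          if_neg (Nat.not_odd_iff_even.2 ht)] at h
        simp at h
      · rw [blockCenter, blockCenter, if_neg (Nat.not_odd_iff_even.2 (ht.add_odd hs)),
          if_pos ht] at h
        simp at h
  rintro (_ | a) (_ | b) h
  · rfl
  · exact absurd h.symm (key b)
  · exact absurd h (key a)
  · rw [centerMap_some_inj h]

theorem existsUnique_of_chain (hu : IsConfluentFixedPoint t s u)
    (hinj : ∀ (c₁ c₂ : Option (Fin m)) (v₁ v₂ : ℕ → Fin m), IsBranchHalf u c₁ v₁ →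
      IsBranchHalf u c₂ v₂ → centerMap t s c₁ = centerMap t s c₂ → c₁ = c₂)
    {c : Option (Fin m)} (h : HasPalindromicChain u c) : ∃! v, IsBranchHalf u c v := by
  obtain ⟨v, hv⟩ := h.exists_isBranchHalf
  exact ⟨v, hv, fun w hw => isBranchHalf_unique hu hinj hw hv⟩

theorem existsUnique_of_odd (hu : IsConfluentFixedPoint t s u) (hs : Odd s)
    (c : Option (Fin m)) : ∃! v, IsBranchHalf u c v := by
  refine existsUnique_of_chain hu (fun c₁ c₂ _ _ _ _ h => centerMap_injective hs h) ?_
  rcases Nat.even_or_odd t with ht | ht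
  · rcases c with _ | a
    · exact hasPalindromicChain_none_of_even hu ht
    · exact hasPalindromicChain_some_of_odd hu (ht.add_odd hs) a
  -- For t odd the orbit is 0 → 1 → ⋯ → m-1 → ε → 0, of length m+1.
  · have hlen : (centerMap t s)^[m] (some (0 : Fin m)) = none := by
      rw [iterate_centerMap_length, blockCenter, if_neg (Nat.not_odd_iff_even.2 (ht.add_odd hs))]
    have h0 : HasPalindromicChain u (some (0 : Fin m)) := by
      refine hasPalindromicChain_zero hu (n := m) ?_
      rw [Function.iterate_succ_apply', hlen, centerMap, blockCenter, if_pos ht]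
    rcases c with _ | a
    · rw [← hlen]
      exact h0.iterate hu m
    · exact hasPalindromicChain_some hu h0 a

/-- Both t and t+s are odd, so every image of a center is a letter. -/
theorem not_isBranchHalf_none (hu : IsConfluentFixedPoint t s u) (hs : Even s) (ht : Odd t)
    (v : ℕ → Fin m) : ¬ IsBranchHalf u none v := by
  intro hv
  obtain ⟨c, _, hc, -⟩ := exists_preimage_branch hu hv
  rcases c with _ | a
  · simp [centerMap, blockCenter, ht] at hc
  · simp only [centerMap, blockCenter, if_pos (ht.add_even hs)] at hc
    split_ifs at hc

/-- Both t and t+s are even, so 0 has no preimage and the only preimage of a+1 is a; induct on the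
letter. -/
theorem not_isBranchHalf_some (hu : IsConfluentFixedPoint t s u) (hs : Even s) (ht : Even t)
    (a : Fin m) (v : ℕ → Fin m) : ¬ IsBranchHalf u (some a) v := by
  have key : ∀ n, ∀ a : Fin m, (a : ℕ) = n → ∀ v, ¬ IsBranchHalf u (some a) v := by
    intro n
    induction n with
    | zero =>
      intro a ha v hv
      obtain ⟨c, _, hc, -⟩ := exists_preimage_branch hu hv
      rcases c with _ | b
      · simp [centerMap, blockCenter, Nat.not_odd_iff_even.2 ht] at hc
      · simp only [centerMap, blockCenter, if_neg (Nat.not_odd_iff_even.2 (ht.add hs))] at hc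
        split_ifs at hc
        simp [Fin.ext_iff] at hc
        omega
    | succ n ih =>
      intro a ha v hv
      obtain ⟨c, v', hc, hv', -⟩ := exists_preimage_branch hu hv
      rcases c with _ | b
      · simp [centerMap, blockCenter, Nat.not_odd_iff_even.2 ht] at hc
      · simp only [centerMap, blockCenter, if_neg (Nat.not_odd_iff_even.2 (ht.add hs))] at hc
        split_ifs at hc
        simp [Fin.ext_iff] at hc
        exact ih b (by omega) v' hv'
  exact key a a rfl v

end Branches

/-! ### From the Rényi expansion to the fixed point -/

section Renyi

variable {β : ℝ} {m t s : ℕ}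

theorem IsConfluent.one_le_last (hβ : IsConfluent β m t s) : 1 ≤ s := by
  rw [← hβ.digit_last]
  exact Nat.one_le_iff_ne_zero.2 hβ.simpleParry.last_ne_zero

/-- The first digit is ⌊β⌋, and every later digit is ⌊βx⌋ with x < 1. -/
theorem IsConfluent.last_le (hβ : IsConfluent β m t s) : s ≤ t := by
  have hm := hβ.two_le
  have hpos := hβ.simpleParry.one_lt
  rw [← hβ.digit_last, ← hβ.digit_eq 1 le_rfl hm, renyiDigit, renyiDigit]
  apply Nat.floor_le_floor
  obtain ⟨k, hk⟩ := Nat.exists_eq_add_of_le' (show 1 ≤ m - 1 by omega)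
  rw [hk, Function.iterate_succ_apply']
  have h1 : betaTransform β ((betaTransform β)^[k] 1) ≤ 1 := (Int.fract_lt_one _).le
  simpa using mul_le_mul_of_nonneg_left h1 (by linarith : (0 : ℝ) ≤ β)

variable [NeZero m]

theorem IsConfluent.parrySubst_eq (hβ : IsConfluent β m t s) :
    parrySubst (renyiDigit β) m = confluentSubst t s := by
  funext a
  have := a.isLt
  unfold parrySubst confluentSubst
  by_cases h : (a : ℕ) + 1 < m
  · rw [dif_pos h, dif_pos h, hβ.digit_eq _ (by omega) h]
  · rw [dif_neg h, dif_neg h, show (a : ℕ) + 1 = m by omega, hβ.digit_last, List.append_nil]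

theorem isInitial_betaIterate (hβ : IsConfluent β m t s) (n : ℕ) :
    IsInitial (uBeta β m) (betaIterate β m n) :=
  isInitial_iff.2 fun i hi => (uBeta_eq hβ.simpleParry hβ.two_le n i hi).symm

theorem IsConfluent.isConfluentFixedPoint (hβ : IsConfluent β m t s) :
    IsConfluentFixedPoint t s (uBeta β m) where
  two_le := hβ.two_le
  one_le := hβ.one_le_last
  le := hβ.last_le
  map_zero := by simp [uBeta, betaIterate]
  fixed r := by
    -- The prefix of length r of u lies in φ^r(0), so its image is a prefix of φ^(r+1)(0).
    refine IsInitial.of_prefix ?_ (isInitial_betaIterate hβ (r + 1))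
    rw [betaIterate_succ, hβ.parrySubst_eq]
    apply applyMorphism_prefix
    rw [isInitial_betaIterate hβ r]
    exact map_range_prefix _ (betaIterate_length hβ.simpleParry hβ.two_le r).le

end Renyi

theorem mainTheorem5 (β : ℝ) (m t s : ℕ) [NeZero m] (hβ : IsConfluent β m t s) :
    (Odd s → ∀ c : Option (Fin m), ∃! w : ℤ → Fin m,
      IsInfinitePalindromicBranch (uBeta β m) c w) ∧
    (Even s → Odd t →
      (∀ a : Fin m, ∃! w : ℤ → Fin m, IsInfinitePalindromicBranch (uBeta β m) (some a) w) ∧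
      ¬ ∃ w : ℤ → Fin m, IsInfinitePalindromicBranch (uBeta β m) none w) ∧
    (Even s → Even t →
      (∃! w : ℤ → Fin m, IsInfinitePalindromicBranch (uBeta β m) none w) ∧
      ∀ a : Fin m, ¬ ∃ w : ℤ → Fin m, IsInfinitePalindromicBranch (uBeta β m) (some a) w) := by
  have hu := hβ.isConfluentFixedPoint
  simp only [existsUnique_branch_iff, exists_branch_iff]
  refine ⟨fun hs c => existsUnique_of_odd hu hs c, fun hs ht => ⟨fun a => ?_, ?_⟩,
    fun hs ht => ⟨?_, ?_⟩⟩
  -- For s even, m-1 and ε do collide; uniqueness survives because ε carries no branch here, and no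
  -- letter does when t is even.
  · refine existsUnique_of_chain hu ?_ (hasPalindromicChain_some_of_odd hu (ht.add_even hs) a)
    rintro (_ | a) (_ | b) v w hv hw h
    · rfl
    · exact absurd hv (not_isBranchHalf_none hu hs ht v)
    · exact absurd hw (not_isBranchHalf_none hu hs ht w)
    · rw [centerMap_some_inj h]
  · rintro ⟨v, hv⟩
    exact not_isBranchHalf_none hu hs ht v hv
  · refine existsUnique_of_chain hu ?_ (hasPalindromicChain_none_of_even hu ht)
    rintro (_ | a) (_ | b) v w hv hw h
    · rfl
    · exact absurd hw (not_isBranchHalf_some hu hs ht b w)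
    · exact absurd hv (not_isBranchHalf_some hu hs ht a v)
    · rw [centerMap_some_inj h]
  · rintro a ⟨v, hv⟩
    exact not_isBranchHalf_some hu hs ht a v hv
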